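/- Let $K$ be a totally real number field and let $\mathcal O^+$ be the set of totally positive algebraic integers of $K$. Call $\gamma\in\mathcal O^+$ \emph{primitive} if $\gamma\notin n\mathcal O^+$ for every integer $n\ge 2$. Every $\delta\in\mathcal O^+$ can be written uniquely as $\delta=s(\delta)\gamma$ with $s(\delta)\in\mathbb Z^+$ and $\gamma$ primitive; $s(\delta)$ is called the \emph{scale} of $\delta$. A \emph{partition} of $\delta\in\mathcal O^+$ is a finite sequence of elements of $\mathcal O^+$ (its parts) with sum $\delta$, considered up to order, and $\oplus$ denotes concatenation of partitions. For a set $S$ of partitions let $p(S,\delta)$ be the number of partitions of $\delta$ that belong to $S$. Let $k,i$ be integers with $1\le i\le k$. Let $\mathscr A'_{k,i}$ be the set of all partitions all of whose parts have scale $\not\equiv 0,\pm i\pmod{2k+1}$. For primitive $\gamma$ let $\mathscr B'_{k,i,\gamma}$ be the set of all partitions of the form $(b_1\gamma,b_2\gamma,\ldots,b_m\gamma)$ with integers $b_1\ge b_2\ge\cdots\ge b_m\ge 1$ such that $b_j-b_{j+k-1}\ge 2$ whenever $1\le j\le m-k+1$, and $b_{m-i+1}\ge 2$ if $m\ge i$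 (equivalently, at most $i-1$ of the parts are equal to $\gamma$). Let $\mathscr B'_{k,i}$ be the set of all partitions $\lambda^{(1)}\oplus\cdots\oplus\lambda^{(l)}$ for which there are pairwise distinct primitive $\gamma_1,\ldots,\gamma_l$ with $\lambda^{(h)}\in\mathscr B'_{k,i,\gamma_h}$ for all $h$. Then for every $\delta\in\mathcal O^+$ the numbers $p(\mathscr A'_{k,i},\delta)$ and $p(\mathscr B'_{k,i},\delta)$ are finite and $$p(\mathscr A'_{k,i},\delta)=p(\mathscr B'_{k,i},\delta).$$ In particular this holds for all $k\ge 2$ and $1\le i\le k$. -/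

import Mathlib

namespace RadialPartition

open NumberField

/-- The set `𝓞⁺` of totally positive algebraic integers of `K`, as a type. For a totally real
field the real embeddings are all the embeddings. -/
def TotPos (K : Type*) [Field K] : Type _ :=
  {x : 𝓞 K // ∀ φ : K →+* ℝ, 0 < φ (x : K)}

/-- `γ ∈ 𝓞⁺` is primitive (over `ℚ`) if it does not lie in `n 𝓞⁺` for any rational integer
`n ≥ 2`, that is, for any non-unit `n` of `ℤ⁺`. -/
def IsPrimitive {K : Type*} [Field K] (γ : TotPos K) : Prop :=
  ∀ n : ℕ, 2 ≤ n → ∀ β : TotPos K, γ.1 ≠ (n : 𝓞 K) * β.1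

/-- If `n β` is totally positive and `n > 0`, so is `β`. -/
theorem totPos_of_natCast_mul {K : Type*} [Field K] {x β : 𝓞 K} {n : ℕ} (hn : 0 < n)
    (hx : ∀ φ : K →+* ℝ, 0 < φ (x : K)) (h : x = (n : 𝓞 K) * β) :
    ∀ φ : K →+* ℝ, 0 < φ (β : K) := by
  intro φ
  have h1 := hx φ
  rw [h] at h1
  simp only [map_mul, map_natCast] at h1
  have h2 : (0 : ℝ) < n := by exact_mod_cast hn
  exact (mul_pos_iff_of_pos_left h2).1 h1

theorem TotPos.ne_zero {K : Type*} [Field K] [NumberField K] [IsTotallyReal K]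
    (δ : TotPos K) : δ.1 ≠ 0 := by
  intro h
  obtain ⟨w⟩ : Nonempty (InfinitePlace K) := inferInstance
  have h1 := δ.2 (InfinitePlace.embedding_of_isReal (IsTotallyReal.isReal w))
  rw [h] at h1
  simp at h1

/-- One half of the uniqueness of the radial decomposition. -/
theorem dvd_of_radial {K : Type*} [Field K] [NumberField K] {m n : ℕ} (hm : 0 < m)
    {γ γ' : TotPos K} (hγ : IsPrimitive γ) (h : (m : 𝓞 K) * γ.1 = (n : 𝓞 K) * γ'.1)
    (hn : 0 < n) : n ∣ m := by
  obtain ⟨g, a, b, hg, hab, rfl, rfl⟩ := Nat.exists_coprime' (Nat.gcd_pos_of_pos_left n hm)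
  have hg0 : (g : 𝓞 K) ≠ 0 := by exact_mod_cast hg.ne'
  have h' : (a : 𝓞 K) * γ.1 = (b : 𝓞 K) * γ'.1 := by
    apply mul_left_cancel₀ hg0
    push_cast at h
    linear_combination h
  have hb : 0 < b := Nat.pos_of_mul_pos_right hn
  obtain ⟨x, y, hxy⟩ : IsCoprime (a : ℤ) (b : ℤ) := Nat.isCoprime_iff_coprime.2 hab
  have hxy' : (x : 𝓞 K) * (a : 𝓞 K) + (y : 𝓞 K) * (b : 𝓞 K) = 1 := by exact_mod_cast hxy
  have hβ : γ.1 = (b : 𝓞 K) * ((x : 𝓞 K) * γ'.1 + (y : 𝓞 K) * γ.1) := by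
    linear_combination (-γ.1) * hxy' + (x : 𝓞 K) * h'
  have hb1 : b = 1 := by
    by_contra hne
    exact hγ b (by omega) ⟨_, totPos_of_natCast_mul hb γ.2 hβ⟩ hβ
  subst hb1
  simp

/-- Existence and uniqueness of the scale in the radial decomposition `δ = n γ`,
`n ∈ ℤ⁺`, `γ` primitive. -/
theorem existsUnique_scale {K : Type*} [Field K] [NumberField K] [IsTotallyReal K]
    (δ : TotPos K) :
    ∃! n : ℕ, 0 < n ∧ ∃ γ : TotPos K, IsPrimitive γ ∧ δ.1 = (n : 𝓞 K) * γ.1 := by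
  classical
  have hN : Algebra.norm ℤ δ.1 ≠ 0 := by
    rw [Ne, Algebra.norm_eq_zero_iff]
    exact δ.ne_zero
  let P : ℕ → Prop := fun n => 0 < n ∧ ∃ β : TotPos K, δ.1 = (n : 𝓞 K) * β.1
  have hbound : ∀ n, P n → n ≤ (Algebra.norm ℤ δ.1).natAbs := by
    rintro n ⟨hn, β, hβ⟩
    apply Nat.le_of_dvd (Int.natAbs_pos.2 hN)
    rw [← Int.natCast_dvd, hβ, map_mul]
    apply Dvd.dvd.mul_right
    have : (n : 𝓞 K) = algebraMap ℤ (𝓞 K) (n : ℤ) := by simp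
    rw [this, Algebra.norm_algebraMap_of_basis (RingOfIntegers.basis K)]
    apply dvd_pow_self
    rw [← Module.finrank_eq_card_basis (RingOfIntegers.basis K), RingOfIntegers.rank]
    exact Module.finrank_pos.ne'
  have h1 : P 1 := ⟨one_pos, δ, by simp⟩
  have hmax : P (Nat.findGreatest P (Algebra.norm ℤ δ.1).natAbs) :=
    Nat.findGreatest_spec (hbound 1 h1) h1
  set n := Nat.findGreatest P (Algebra.norm ℤ δ.1).natAbs with hn
  obtain ⟨hn0, γ, hγ⟩ := hmax
  refine ⟨n, ⟨hn0, γ, ?_, hγ⟩, ?_⟩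
  · intro m hm β hβ
    have hP : P (n * m) := ⟨by positivity, β, by rw [hγ, hβ]; push_cast; ring⟩
    have := Nat.le_findGreatest (hbound _ hP) hP
    rw [← hn] at this
    nlinarith
  · rintro m ⟨hm, γ', hγ', hδ⟩
    have hpr : IsPrimitive γ := by
      intro m hm β hβ
      have hP : P (n * m) := ⟨by positivity, β, by rw [hγ, hβ]; push_cast; ring⟩
      have := Nat.le_findGreatest (hbound _ hP) hP
      rw [← hn] at this
      nlinarith
    exact Nat.dvd_antisymm (dvd_of_radial hn0 hpr (hγ.symm.trans hδ) hm)
      (dvd_of_radial hm hγ' (hδ.symm.trans hγ) hn0)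

/-- The scale `s(δ)`: the positive integer `n` with `δ = n γ` for a primitive `γ`. -/
noncomputable def scale {K : Type*} [Field K] [NumberField K] [IsTotallyReal K]
    (δ : TotPos K) : ℕ :=
  (existsUnique_scale δ).choose

/-- `lam ⊢ δ`. A partition is a multiset of totally positive integers, since partitions are
considered up to the order of the parts; `lam ⊕ lam'` is then `lam + lam'`. -/
def IsPartitionOf {K : Type*} [Field K] (lam : Multiset (TotPos K)) (δ : TotPos K) : Prop :=
  (lam.map Subtype.val).sum = δ.1

/-- The set of all partitions of all `δ ∈ 𝓞⁺`. -/
def allPartitions (K : Type*) [Field K] : Set (Multiset (TotPos K)) :=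
  {lam | ∃ δ : TotPos K, IsPartitionOf lam δ}

/-- The set of partitions of `δ` that belong to `S`. -/
def partitionsIn {K : Type*} [Field K] (S : Set (Multiset (TotPos K))) (δ : TotPos K) :
    Set (Multiset (TotPos K)) :=
  {lam ∈ S | IsPartitionOf lam δ}

/-- `p(S, δ)`: the number of partitions of `δ` that belong to `S`. -/
noncomputable def p {K : Type*} [Field K] (S : Set (Multiset (TotPos K))) (δ : TotPos K) : ℕ :=
  (partitionsIn S δ).ncard

/-- All partitions each of whose parts has scale not congruent to `0, i, -i` modulo `2k+1`. -/
def setA (K : Type*) [Field K] [NumberField K] [IsTotallyReal K] (k i : ℕ) :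
    Set (Multiset (TotPos K)) :=
  {lam ∈ allPartitions K | ∀ x ∈ lam,
    ¬ (scale x : ℤ) ≡ 0 [ZMOD 2 * k + 1] ∧
    ¬ (scale x : ℤ) ≡ i [ZMOD 2 * k + 1] ∧
    ¬ (scale x : ℤ) ≡ -i [ZMOD 2 * k + 1]}

/-- Gordon's conditions on `b₁ ≥ b₂ ≥ ⋯ ≥ bₘ ≥ 1`: `b_j - b_{j+k-1} ≥ 2` for all `j` and
`b_{m-i+1} ≥ 2`, each imposed whenever the indices lie in `{1, …, m}`. In the code the indices
start at `0`. -/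
structure IsGordon (k i : ℕ) (b : List ℕ) : Prop where
  pos : ∀ n ∈ b, 1 ≤ n
  antitone : b.Pairwise (· ≥ ·)
  diff : ∀ (j l : ℕ) (hj : j < b.length) (hl : l < b.length),
    l + 1 = j + k → b[l] + 2 ≤ b[j]
  last : ∀ (j : ℕ) (hj : j < b.length), j + i = b.length → 2 ≤ b[j]

/-- All partitions `(b₁ γ, …, bₘ γ)` in the `γ`-section with `b` satisfying Gordon's conditions. -/
def sectionalB {K : Type*} [Field K] (k i : ℕ) (γ : TotPos K) : Set (Multiset (TotPos K)) :=
  {lam ∈ allPartitions K | ∃ b : List ℕ, IsGordon k i b ∧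
    lam.map Subtype.val = ↑(b.map fun n : ℕ => (n : 𝓞 K) * γ.1)}

/-- All partitions `lam⁽¹⁾ ⊕ ⋯ ⊕ lam⁽ˡ⁾` for which there are pairwise distinct primitive
`γ₁, …, γₗ` such that `lam⁽ʰ⁾` is a `γₕ`-sectional partition satisfying Gordon's conditions. -/
def setB (K : Type*) [Field K] (k i : ℕ) : Set (Multiset (TotPos K)) :=
  {lam ∈ allPartitions K | ∃ (l : ℕ) (γ : Fin l → TotPos K) (mu : Fin l → Multiset (TotPos K)),
    Function.Injective γ ∧ (∀ h, IsPrimitive (γ h)) ∧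
    (∀ h, mu h ∈ sectionalB k i (γ h)) ∧ lam = ∑ h, mu h}

end RadialPartition

/-! Every totally positive integer is uniquely a scale times a primitive element, so a partition of
`δ` is the same as a family of ordinary integer partitions, one for each primitive direction `γ`,
almost all empty: its sections `sec γ lam`. Both conditions are conditions on each section
separately, namely parts not congruent to 0 or ±i modulo 2k+1 on one side, and Gordon's difference
conditions on the other (`mem_partitionsIn_setA`, `mem_partitionsIn_setB`). A section `m`
contributes |m|γ to the sum, so a size-preserving bijection between the two classes of integer
partitions, applied in every direction, preserves `δ` (`ncard_eq_of_equiv`). Finiteness holds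
because every part of `δ` is bounded by `δ` in each real embedding.

The bijection comes from Gordon's theorem, proved by generating functions in a commutative ring with
q^L = 0, so that all series and products are finite and every 1 - q^n with n ≥ 1 is a unit.
Specialising to ℤ[X]/(X^L) recovers the coefficients below L (`card_filter_sum_eq`). With k = i + d,
`gordonSum` is Andrews' alternating series at x = q^N, multiplied by (q)_∞ to clear denominators. It
obeys the recursion obtained by removing all parts N+1 from a Gordon partition (`gordonSum_eq_sum`),
and it reduces to (q)_∞ for large N, so it equals (q)_∞ times the generating function
(`qPoch_mul_sum_gordon`). At N = 0 it is a theta series, and the Jacobi triple product turns it into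
the product of the factors 1 - q^n with n ≡ 0, ±i. Dividing by (q)_∞ leaves the generating function
of the allowed partitions. -/

/-! ### Gaussian binomial coefficients and the finite Jacobi triple product -/

namespace QSeries

open Finset

variable {R : Type*} [CommRing R]

/-- The `q`-Pochhammer product `(1 - Q)(1 - Q²)⋯(1 - Qⁿ)`. -/
def qPoch (Q : R) (n : ℕ) : R := ∏ j ∈ range n, (1 - Q ^ (j + 1))

theorem qPoch_succ (Q : R) (n : ℕ) : qPoch Q (n + 1) = qPoch Q n * (1 - Q ^ (n + 1)) :=
  prod_range_succ _ _

theorem isUnit_one_sub_pow {q : R} (hq : IsNilpotent q) (n : ℕ) : IsUnit (1 - q ^ (n + 1)) :=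
  (hq.pow_of_pos n.succ_ne_zero).isUnit_one_sub

theorem isUnit_qPoch {Q : R} (hQ : IsNilpotent Q) (n : ℕ) : IsUnit (qPoch Q n) := by
  induction n with
  | zero => simp [qPoch]
  | succ n ih => rw [qPoch_succ]; exact ih.mul (isUnit_one_sub_pow hQ n)

theorem pow_eq_zero_of_le_exp {q : R} {L n : ℕ} (hq : q ^ L = 0) (h : L ≤ n) : q ^ n = 0 :=
  pow_eq_zero_of_le h hq

/-- Factors whose exponent is at least L equal 1, so the product is stationary and its stable value
plays the role of (Q)_∞. -/
theorem qPoch_eq_of_le {Q : R} {L m n : ℕ} (hQ : Q ^ L = 0) (hm : L ≤ m + 1) (hmn : m ≤ n) :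
    qPoch Q n = qPoch Q m := by
  induction n, hmn using Nat.le_induction with
  | base => rfl
  | succ n hn ih =>
    rw [qPoch_succ, ih, pow_eq_zero_of_le_exp hQ (by omega), sub_zero, mul_one]

/-- Gaussian binomial coefficients. -/
def gaussBinom (Q : R) : ℕ → ℕ → R
  | _, 0 => 1
  | 0, _ + 1 => 0
  | n + 1, r + 1 => gaussBinom Q n (r + 1) + Q ^ (n - r) * gaussBinom Q n r

@[simp] theorem gaussBinom_zero_right (Q : R) (n : ℕ) : gaussBinom Q n 0 = 1 := by
  cases n <;> rfl

theorem gaussBinom_succ_succ (Q : R) (n r : ℕ) : gaussBinom Q (n + 1) (r + 1) =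
    gaussBinom Q n (r + 1) + Q ^ (n - r) * gaussBinom Q n r := rfl

theorem gaussBinom_eq_zero_of_lt (Q : R) {n r : ℕ} (h : n < r) : gaussBinom Q n r = 0 := by
  induction n generalizing r with
  | zero => obtain ⟨r, rfl⟩ := Nat.exists_eq_succ_of_ne_zero h.ne'; rfl
  | succ n ih =>
    obtain ⟨r, rfl⟩ := Nat.exists_eq_succ_of_ne_zero (by omega : r ≠ 0)
    rw [Nat.succ_eq_add_one, gaussBinom_succ_succ, ih (by omega), ih (by omega)]
    simp

theorem gaussBinom_self (Q : R) (n : ℕ) : gaussBinom Q n n = 1 := by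
  induction n with
  | zero => simp
  | succ n ih => rw [gaussBinom_succ_succ, gaussBinom_eq_zero_of_lt Q n.lt_succ_self, ih]; simp

/-- Division-free form of the quotient formula, valid without inverting anything. -/
theorem gaussBinom_mul_qPoch (Q : R) (r s : ℕ) :
    gaussBinom Q (r + s) r * (qPoch Q r * qPoch Q s) = qPoch Q (r + s) := by
  induction r generalizing s with
  | zero => simp [qPoch]
  | succ r ihr =>
    induction s with
    | zero => simp [gaussBinom_self, qPoch]
    | succ s ihs =>
      have h1 := ihr (s + 1)
      rw [show r + 1 + (s + 1) = (r + 1 + s) + 1 by ring, gaussBinom_succ_succ,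
        show r + 1 + s - r = s + 1 by omega, qPoch_succ Q (r + 1 + s)]
      rw [show r + (s + 1) = r + 1 + s by ring] at h1
      have e : qPoch Q (s + 1) = qPoch Q s * (1 - Q ^ (s + 1)) := qPoch_succ _ _
      have e' : qPoch Q (r + 1) = qPoch Q r * (1 - Q ^ (r + 1)) := qPoch_succ _ _
      rw [e] at h1 ⊢
      rw [e'] at ihs ⊢
      have e2 : Q ^ (r + 1 + s + 1) = Q ^ (s + 1) * Q ^ (r + 1) := by rw [← pow_add]; congr 1; ring
      rw [e2]
      -- Pascal's rule, combined with 1 - Q^(r+s+2) = (1 - Q^(s+1)) + Q^(s+1)(1 - Q^(r+1)).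
      linear_combination (1 - Q ^ (s + 1)) * ihs + Q ^ (s + 1) * (1 - Q ^ (r + 1)) * h1

theorem gaussBinom_symm {Q : R} (hQ : IsNilpotent Q) {n r : ℕ} (h : r ≤ n) :
    gaussBinom Q n (n - r) = gaussBinom Q n r := by
  obtain ⟨s, rfl⟩ := Nat.exists_eq_add_of_le h
  have h1 := gaussBinom_mul_qPoch Q r s
  have h2 := gaussBinom_mul_qPoch Q s r
  rw [show r + s - r = s by omega]
  apply ((isUnit_qPoch hQ r).mul (isUnit_qPoch hQ s)).mul_right_cancel
  rw [h1, mul_comm (qPoch Q r), add_comm r s, h2]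

/-- The triangular number `j (j + 1) / 2` of an integer. -/
def tri (j : ℤ) : ℕ := (j * (j + 1) / 2).toNat

theorem two_mul_tri (j : ℤ) : 2 * (tri j : ℤ) = j * (j + 1) := by
  have h0 : 0 ≤ j * (j + 1) := by
    rcases le_or_gt 0 j with h | h
    · positivity
    · exact mul_nonneg_of_nonpos_of_nonpos h.le (by omega)
  have h2 : (2 : ℤ) ∣ j * (j + 1) := (Int.even_mul_succ_self j).two_dvd
  unfold tri
  rw [Int.toNat_of_nonneg (by positivity), Int.mul_ediv_cancel' h2]

theorem tri_sub_one (j : ℤ) : (tri j : ℤ) = tri (j - 1) + j := by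
  have h1 := two_mul_tri j
  have h2 := two_mul_tri (j - 1)
  linarith

theorem tri_neg (j : ℤ) : tri (-j) = tri (j - 1) := by
  have h1 := two_mul_tri (-j)
  have h2 := two_mul_tri (j - 1)
  zify; linarith

/-- The general term of Ramanujan's theta series `f(-u, -v)`. -/
def thetaTerm (u v : R) (j : ℤ) : R := (-1) ^ j.natAbs * u ^ tri j * v ^ tri (j - 1)

theorem thetaTerm_neg (u v : R) (j : ℤ) : thetaTerm u v (-j) = thetaTerm v u j := by
  unfold thetaTerm
  rw [Int.natAbs_neg, tri_neg, show -j - 1 = -(j + 1) by ring, tri_neg, add_sub_cancel_right]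
  ring

/-- Consecutive theta terms have ratio -u(uv)^(j-1). The natural number `a` stands for m + 1 - j,
which avoids negative powers. -/
theorem thetaTerm_shift (u v : R) (j : ℤ) (m : ℕ) (a : ℕ) (h : (a : ℤ) = m + 1 - j) :
    -(u * (u * v) ^ m) * thetaTerm u v (j - 1) = (u * v) ^ a * thetaTerm u v j := by
  have hs : (-1 : R) ^ j.natAbs = - (-1) ^ (j - 1).natAbs := by
    rcases Int.even_or_odd j with he | ho
    · have ho : Odd (j - 1) := he.sub_odd odd_one
      rw [(Int.natAbs_even.2 he).neg_one_pow, (Int.natAbs_odd.2 ho).neg_one_pow]; simp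
    · have he : Even (j - 1) := ho.sub_odd odd_one
      rw [(Int.natAbs_odd.2 ho).neg_one_pow, (Int.natAbs_even.2 he).neg_one_pow]
  have e1 : 1 + m + tri (j - 1) = a + tri j := by
    have := tri_sub_one j; omega
  have e2 : m + tri (j - 1 - 1) = a + tri (j - 1) := by
    have := tri_sub_one (j - 1); omega
  unfold thetaTerm
  rw [hs]
  calc _ = -((-1) ^ (j - 1).natAbs * u ^ (1 + m + tri (j - 1)) * v ^ (m + tri (j - 1 - 1))) := by
        rw [mul_pow]; ring
    _ = _ := by rw [e1, e2, mul_pow]; ring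

/-- In Pascal's rule one half reproduces the sum, and the other, by `thetaTerm_shift`, is the same
sum times -u(uv)^m. -/
theorem finite_theta_step (u v : R) (m n : ℕ) :
    (1 - u * (u * v) ^ m) *
      ∑ r ∈ range (m + n + 1), gaussBinom (u * v) (m + n) r * thetaTerm u v (r - n) =
    ∑ r ∈ range (m + n + 2), gaussBinom (u * v) (m + n + 1) r * thetaTerm u v (r - n) := by
  rw [sum_range_succ' _ (m + n + 1)]
  simp only [gaussBinom_succ_succ, add_mul, sum_add_distrib]
  have h1 : ∑ r ∈ range (m + n + 1), gaussBinom (u * v) (m + n) (r + 1) *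
      thetaTerm u v ((r + 1 : ℕ) - n) + gaussBinom (u * v) (m + n + 1) 0 *
      thetaTerm u v ((0 : ℕ) - n) =
      ∑ r ∈ range (m + n + 1), gaussBinom (u * v) (m + n) r * thetaTerm u v (r - n) := by
    have := sum_range_succ' (fun r : ℕ => gaussBinom (u * v) (m + n) r * thetaTerm u v (r - n))
      (m + n + 1)
    rw [sum_range_succ, gaussBinom_eq_zero_of_lt _ (m + n).lt_succ_self] at this
    simp only [zero_mul, add_zero] at this
    rw [this]
    simp
  have h2 : ∑ r ∈ range (m + n + 1), (u * v) ^ (m + n - r) * gaussBinom (u * v) (m + n) r *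
      thetaTerm u v ((r + 1 : ℕ) - n) =
      -(u * (u * v) ^ m) *
      ∑ r ∈ range (m + n + 1), gaussBinom (u * v) (m + n) r * thetaTerm u v (r - n) := by
    rw [mul_sum]
    refine sum_congr rfl fun r hr => ?_
    rw [mem_range] at hr
    have := thetaTerm_shift u v ((r + 1 : ℕ) - n) m (m + n - r) (by push_cast; omega)
    rw [show ((r + 1 : ℕ) : ℤ) - n - 1 = r - n by push_cast; ring] at this
    linear_combination - gaussBinom (u * v) (m + n) r * this
  linear_combination -h1 - h2

theorem finite_theta_zero (u v : R) (m : ℕ) :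
    ∏ j ∈ range m, (1 - u * (u * v) ^ j) =
      ∑ r ∈ range (m + 1), gaussBinom (u * v) m r * thetaTerm u v r := by
  induction m with
  | zero => simp [thetaTerm, tri]
  | succ m ih =>
    have := finite_theta_step u v m 0
    simp only [add_zero, Nat.cast_zero, sub_zero] at this
    rw [prod_range_succ, ih, mul_comm, this]

/-- The finite form of the Jacobi triple product identity. -/
theorem finite_jacobi {u v : R} (h : IsNilpotent (u * v)) (m n : ℕ) :
    (∏ j ∈ range m, (1 - u * (u * v) ^ j)) * ∏ j ∈ range n, (1 - v * (u * v) ^ j) =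
      ∑ r ∈ range (m + n + 1), gaussBinom (u * v) (m + n) r * thetaTerm u v (r - n) := by
  induction m with
  | zero =>
    -- With m = 0, the one-sided identity with u and v exchanged applies; reflecting the index and
    -- `thetaTerm_neg` exchange them back.
    have := finite_theta_zero v u n
    rw [mul_comm v u] at this
    rw [prod_range_zero, one_mul, this, zero_add, ← sum_range_reflect]
    refine sum_congr rfl fun r hr => ?_
    rw [mem_range] at hr
    rw [show n + 1 - 1 - r = n - r by omega, gaussBinom_symm h (by omega), ← thetaTerm_neg]
    congr 2
    omega
  | succ m ih =>
    rw [show m + 1 + n = m + n + 1 by ring, ← finite_theta_step, ← ih, prod_range_succ]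
    ring

theorem le_tri {j : ℤ} {L : ℕ} (h : L ≤ j ∨ j ≤ -(L : ℤ) - 1) : L ≤ tri j := by
  have h1 := two_mul_tri j
  zify
  rcases h with h | h <;> nlinarith

/-- The Jacobi triple product identity at `u = q ^ a`, `v = q ^ b`, modulo `q ^ L`. -/
theorem jacobi_triple_product {q : R} {L a b C : ℕ} (hq : q ^ L = 0) (ha : 0 < a) (hb : 0 < b)
    (hC : 2 * L ≤ C) :
    ∑ n ∈ range (C + 1), (thetaTerm (q ^ a) (q ^ b) (-n) + thetaTerm (q ^ a) (q ^ b) (n + 1)) =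
      qPoch (q ^ (a + b)) L * ((∏ j ∈ range (C + 1), (1 - q ^ (a + (a + b) * j))) *
        ∏ j ∈ range C, (1 - q ^ (b + (a + b) * j))) := by
  have hQ : q ^ a * q ^ b = q ^ (a + b) := (pow_add _ _ _).symm
  have hQL : (q ^ (a + b)) ^ L = 0 := by
    rw [← pow_mul]; exact pow_eq_zero_of_le_exp hq (Nat.le_mul_of_pos_left _ (by omega))
  have hnil : IsNilpotent (q ^ (a + b)) := ⟨L, hQL⟩
  -- Lengths C + 1 and C make the theta index run from -C to C + 1, which splits exactly into the
  -- pairs -n, n + 1.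
  have key := finite_jacobi (u := q ^ a) (v := q ^ b) (by rwa [hQ]) (C + 1) C
  simp only [hQ] at key
  simp only [pow_add q a (_ * _), pow_add q b (_ * _), pow_mul]
  rw [key, mul_sum]
  have hterm : ∀ r ∈ range (C + 1 + C + 1), qPoch (q ^ (a + b)) L *
      (gaussBinom (q ^ (a + b)) (C + 1 + C) r * thetaTerm (q ^ a) (q ^ b) (r - C)) =
      thetaTerm (q ^ a) (q ^ b) (r - C) := by
    intro r hr
    rw [mem_range] at hr
    -- In the central range both lower Pochhammer products have stabilised, so the Gaussian binomial
    -- is the inverse of `qPoch` at L. Outside it, C ≥ 2L forces the theta term itself to vanish.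
    by_cases hr' : L ≤ r ∧ r + L ≤ 2 * C + 1
    · obtain ⟨s, hs⟩ := Nat.exists_eq_add_of_le (show r ≤ C + 1 + C by omega)
      have h1 := gaussBinom_mul_qPoch (q ^ (a + b)) r s
      rw [← hs, qPoch_eq_of_le hQL (by omega) (show L ≤ r by omega),
        qPoch_eq_of_le hQL (by omega) (show L ≤ s by omega),
        qPoch_eq_of_le hQL (by omega) (show L ≤ C + 1 + C by omega)] at h1
      have hu := isUnit_qPoch hnil L
      have h2 : gaussBinom (q ^ (a + b)) (C + 1 + C) r * qPoch (q ^ (a + b)) L = 1 :=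
        hu.mul_right_cancel (by rw [one_mul, mul_assoc, h1])
      rw [← mul_assoc, mul_comm (qPoch _ _), h2, one_mul]
    · have : thetaTerm (q ^ a) (q ^ b) (r - C) = 0 := by
        have ht : L ≤ tri ((r : ℤ) - C) := le_tri (by omega)
        unfold thetaTerm
        rw [← pow_mul, pow_eq_zero_of_le_exp hq (ht.trans (Nat.le_mul_of_pos_left _ ha))]
        simp
      rw [this]; simp
  rw [sum_congr rfl hterm, sum_add_distrib, show C + 1 + C + 1 = (C + 1) + (C + 1) by ring,
    sum_range_add _ (C + 1) (C + 1)]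
  congr 1
  · refine (sum_range_reflect (fun n : ℕ => thetaTerm (q ^ a) (q ^ b) (-n)) (C + 1)).symm.trans
      (sum_congr rfl fun r hr => ?_)
    rw [mem_range] at hr
    congr 1
    omega
  · refine sum_congr rfl fun r hr => ?_
    congr 1
    push_cast; ring

/-! ### The series in Gordon's theorem -/

/-- The general term of the series for Gordon partitions with parts exceeding `N` and fewer than
`i` parts `N + 1`, where `k = i + d`. -/
def gordonTerm (q : R) (i d N n : ℕ) : R :=
  (-1) ^ n * q ^ ((i + d) * (N * n + n ^ 2) + d * n + tri n) * (1 - q ^ ((N + 2 * n + 1) * i)) *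
    ∏ j ∈ range N, (1 - q ^ (n + j + 1))

theorem tri_succ (n : ℕ) : tri ((n + 1 : ℕ) : ℤ) = tri (n : ℤ) + (n + 1) := by
  have := tri_sub_one ((n + 1 : ℕ) : ℤ)
  rw [show ((n + 1 : ℕ) : ℤ) - 1 = n by push_cast; ring] at this
  omega

/-- The bracket splits as q^((d+1)n+(N+2n+1)c)(1 - q^(N+n+1)) + q^(dn)(1 - q^n); the two new factors
extend the product by one at the top or at the bottom. -/
theorem gordonTerm_sub (q : R) (c d N n : ℕ) :
    gordonTerm q (c + 1) d N n - gordonTerm q c (d + 1) N n =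
      (-1) ^ n * q ^ ((c + 1 + d) * (N * n + n ^ 2) + tri n + (d + 1) * n + (N + 2 * n + 1) * c) *
        ∏ j ∈ range (N + 1), (1 - q ^ (n + j + 1)) +
      (-1) ^ n * q ^ ((c + 1 + d) * (N * n + n ^ 2) + tri n + d * n) *
        ((1 - q ^ n) * ∏ j ∈ range N, (1 - q ^ (n + j + 1))) := by
  rw [prod_range_succ]
  unfold gordonTerm
  generalize ∏ j ∈ range N, (1 - q ^ (n + j + 1)) = P
  rw [show c + (d + 1) = c + 1 + d by ring]
  generalize (c + 1 + d) * (N * n + n ^ 2) = A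
  simp only [pow_add, add_mul, mul_add, one_mul, mul_one]
  ring

/-- Written to match `gordonTerm_sub`: the first summand is the same, and the second is the second
summand there with n replaced by n + 1. -/
theorem mul_gordonTerm (q : R) (c d N n : ℕ) :
    q ^ ((N + 1) * c) * gordonTerm q (d + 1) c (N + 1) n =
      (-1) ^ n * q ^ ((c + 1 + d) * (N * n + n ^ 2) + tri n + (d + 1) * n + (N + 2 * n + 1) * c) *
        ∏ j ∈ range (N + 1), (1 - q ^ (n + j + 1)) +
      (-1) ^ (n + 1) * q ^ ((c + 1 + d) * (N * (n + 1) + (n + 1) ^ 2) +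
          tri ((n + 1 : ℕ) : ℤ) + d * (n + 1)) *
        ((1 - q ^ (n + 1)) * ∏ j ∈ range N, (1 - q ^ (n + 1 + j + 1))) := by
  have hP : (1 - q ^ (n + 1)) * ∏ j ∈ range N, (1 - q ^ (n + 1 + j + 1)) =
      ∏ j ∈ range (N + 1), (1 - q ^ (n + j + 1)) := by
    rw [prod_range_succ' _ N, mul_comm]
    congr 1
    refine prod_congr rfl fun j _ => ?_
    congr 2; ring
  rw [hP, tri_succ]
  unfold gordonTerm
  generalize ∏ j ∈ range (N + 1), (1 - q ^ (n + j + 1)) = P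
  have e1 : (N + 1) * c + ((d + 1 + c) * ((N + 1) * n + n ^ 2) + c * n + tri n) =
      (c + 1 + d) * (N * n + n ^ 2) + tri n + (d + 1) * n + (N + 2 * n + 1) * c := by ring
  have e2 : (N + 1) * c + ((d + 1 + c) * ((N + 1) * n + n ^ 2) + c * n + tri n) +
      (N + 1 + 2 * n + 1) * (d + 1) =
      (c + 1 + d) * (N * (n + 1) + (n + 1) ^ 2) + (tri n + (n + 1)) + d * (n + 1) := by ring
  rw [← e1, ← e2]
  simp only [pow_add _ _ ((N + 1 + 2 * n + 1) * (d + 1)),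
    pow_add _ ((N + 1) * c), pow_succ (-1 : R)]
  ring

/-- The truncated series for Gordon partitions with parts exceeding `N`. -/
def gordonSum (q : R) (C i d N : ℕ) : R := ∑ n ∈ range C, gordonTerm q i d N n

theorem gordonSum_zero (q : R) (C d N : ℕ) : gordonSum q C 0 d N = 0 := by
  simp [gordonSum, gordonTerm]

theorem gordonSum_succ {q : R} {L C : ℕ} (hq : q ^ L = 0) (hC : L ≤ C) (c d N : ℕ) :
    gordonSum q C (c + 1) d N =
      gordonSum q C c (d + 1) N + q ^ ((N + 1) * c) * gordonSum q C (d + 1) c (N + 1) := by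
  rw [← sub_eq_iff_eq_add']
  unfold gordonSum
  rw [← sum_sub_distrib, mul_sum]
  simp only [gordonTerm_sub, mul_gordonTerm, sum_add_distrib]
  congr 1
  -- Only an index shift in `Y` remains. Its boundary terms vanish: at 0 by the factor 1 - q^0, at C
  -- because the exponent is at least L.
  set Y : ℕ → R := fun n => (-1) ^ n * q ^ ((c + 1 + d) * (N * n + n ^ 2) + tri n + d * n) *
        ((1 - q ^ n) * ∏ j ∈ range N, (1 - q ^ (n + j + 1))) with hY
  have h0 : Y 0 = 0 := by simp [hY]
  have hYC : Y C = 0 := by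
    have : C ≤ (c + 1 + d) * (N * C + C ^ 2) + tri C + d * C := by
      have h1 : C ≤ N * C + C ^ 2 := by nlinarith [Nat.le_self_pow two_ne_zero C]
      have h2 := Nat.le_mul_of_pos_left (N * C + C ^ 2) (show 0 < c + 1 + d by omega)
      omega
    simp only [hY]
    rw [pow_eq_zero_of_le_exp hq (hC.trans this)]
    simp
  have h1 := sum_range_succ Y C
  rw [sum_range_succ', h0, hYC, add_zero, add_zero] at h1
  exact h1.symm

theorem gordonSum_eq_sum {q : R} {L C : ℕ} (hq : q ^ L = 0) (hC : L ≤ C) (i d N : ℕ) :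
    gordonSum q C i d N =
      ∑ c ∈ range i, q ^ ((N + 1) * c) * gordonSum q C (i + d - c) c (N + 1) := by
  induction i generalizing d with
  | zero => simp [gordonSum_zero]
  | succ c ih =>
    rw [gordonSum_succ hq hC, sum_range_succ, ih, show c + 1 + d - c = d + 1 by omega,
      show c + (d + 1) = c + 1 + d by ring]

theorem gordonSum_of_le {q : R} {L C : ℕ} (hq : q ^ L = 0) (hC : 0 < C) {i N : ℕ} (hi : 0 < i)
    (d : ℕ) (hN : L ≤ N + 1) : gordonSum q C i d N = qPoch q L := by
  unfold gordonSum
  rw [sum_eq_single_of_mem 0 (mem_range.2 hC)]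
  · have h0 : tri ((0 : ℕ) : ℤ) = 0 := by simp [tri]
    have hP : ∏ j ∈ range N, (1 - q ^ (j + 1)) = qPoch q L := by
      change qPoch q N = _
      rcases le_total L N with h | h
      · exact qPoch_eq_of_le hq (by omega) h
      · exact (qPoch_eq_of_le hq hN h).symm
    unfold gordonTerm
    rw [pow_eq_zero_of_le_exp hq (n := (N + 2 * 0 + 1) * i) (by nlinarith), h0]
    simp [hP]
  · intro n _ hn
    have hn : 0 < n := Nat.pos_of_ne_zero hn
    have h1 : N + 1 ≤ N * n + n ^ 2 := by nlinarith
    have h2 : N * n + n ^ 2 ≤ (i + d) * (N * n + n ^ 2) := Nat.le_mul_of_pos_left _ (by omega)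
    unfold gordonTerm
    rw [pow_eq_zero_of_le_exp hq (n := (i + d) * (N * n + n ^ 2) + d * n + tri n) (by omega)]
    simp

/-- The two summands of 1 - q^((2n+1)i) give the theta terms of index -n and n + 1. -/
theorem gordonTerm_zero (q : R) (i d n : ℕ) :
    gordonTerm q i d 0 n = thetaTerm (q ^ i) (q ^ (i + 2 * d + 1)) (-n) +
      thetaTerm (q ^ i) (q ^ (i + 2 * d + 1)) (n + 1) := by
  unfold gordonTerm
  rw [thetaTerm_neg]
  unfold thetaTerm
  have h1 := two_mul_tri n
  have h2 := tri_sub_one n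
  have h3 := tri_succ n
  push_cast at h3
  have h4 : ((n : ℤ) + 1).natAbs = n + 1 := by omega
  rw [add_sub_cancel_right, h4, h3, Int.natAbs_natCast]
  obtain ⟨t, ht⟩ : ∃ t, t = tri ((n : ℤ) - 1) := ⟨_, rfl⟩
  have h5 : tri (n : ℤ) = t + n := by omega
  have h6 : n ^ 2 = 2 * t + n := by
    zify; rw [h5] at h1; push_cast at h1; nlinarith
  rw [← ht, h5, h6]
  simp only [← pow_mul]
  have e1 : (i + d) * (0 * n + (2 * t + n)) + d * n + (t + n) =
    (i + 2 * d + 1) * (t + n) + i * t := by ring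
  have e2 : (i + 2 * d + 1) * (t + n) + i * t + (0 + 2 * n + 1) * i =
    i * (t + n + (n + 1)) + (i + 2 * d + 1) * (t + n) := by ring
  rw [prod_range_zero, mul_one, mul_sub, mul_one, e1, mul_assoc, ← pow_add, e2, pow_succ]
  ring

/-! ### The product side -/

/-- The parts allowed on the product side of Gordon's theorem: those not congruent to
`0, ± a` modulo `a + b`. -/
def Allowed (a b n : ℕ) : Prop := n % (a + b) ≠ 0 ∧ n % (a + b) ≠ a ∧ n % (a + b) ≠ b

instance (a b n : ℕ) : Decidable (Allowed a b n) := by unfold Allowed; infer_instance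

theorem prod_range_eq_of_not_allowed {a b : ℕ} (ha : 0 < a) (hab : a < b) (f : ℕ → R) :
    ∏ r ∈ range (a + b), f (r + 1) =
      f (a + b) * (f a * f b) * ∏ r ∈ range (a + b), if Allowed a b (r + 1) then f (r + 1) else 1 := by
  have hf : (range (a + b)).filter (fun r => ¬ Allowed a b (r + 1)) = {a + b - 1, a - 1, b - 1} := by
    ext r
    simp only [mem_filter, mem_range, mem_insert, mem_singleton]
    unfold Allowed
    constructor
    · rintro ⟨hr, h⟩
      rcases eq_or_lt_of_le (show r + 1 ≤ a + b by omega) with h1 | h1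
      · omega
      · rw [Nat.mod_eq_of_lt h1] at h
        omega
    · rintro (rfl | rfl | rfl)
      · rw [show a + b - 1 + 1 = a + b by omega]; simp; omega
      · rw [show a - 1 + 1 = a by omega, Nat.mod_eq_of_lt (by omega)]; omega
      · rw [show b - 1 + 1 = b by omega, Nat.mod_eq_of_lt (by omega)]; omega
  rw [← prod_filter_mul_prod_filter_not _ (fun r => ¬ Allowed a b (r + 1)), hf,
    prod_insert (by simp; omega), prod_insert (by simp; omega), prod_singleton,
    ← prod_filter]
  simp only [not_not]
  rw [show a + b - 1 + 1 = a + b by omega, show a - 1 + 1 = a by omega,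
    show b - 1 + 1 = b by omega]

theorem prod_range_mul_eq (f : ℕ → R) (m C : ℕ) :
    ∏ n ∈ range (m * C), f n = ∏ j ∈ range C, ∏ r ∈ range m, f (m * j + r) := by
  induction C with
  | zero => simp
  | succ C ih => rw [mul_add, mul_one, prod_range_add, ih, prod_range_succ]

/-- Product form of Gordon's series. -/
theorem gordonSum_mul_prod {q : R} {L i d C : ℕ} (hq : q ^ L = 0) (hi : 0 < i) (hC : 2 * L ≤ C) :
    gordonSum q (C + 1) i d 0 *
      ∏ n ∈ range ((i + (i + 2 * d + 1)) * (C + 1)),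
        (if Allowed i (i + 2 * d + 1) (n + 1) then 1 - q ^ (n + 1) else 1) = qPoch q L := by
  obtain ⟨b, hb⟩ : ∃ b, b = i + 2 * d + 1 := ⟨_, rfl⟩
  unfold gordonSum
  simp only [gordonTerm_zero, ← hb]
  rw [jacobi_triple_product hq hi (by omega) hC]
  have h1 : qPoch (q ^ (i + b)) L = ∏ j ∈ range (C + 1), (1 - q ^ ((i + b) * j + (i + b))) := by
    rw [← qPoch_eq_of_le (Q := q ^ (i + b)) (L := L) (n := C + 1) _ (by omega) (by omega)]
    · unfold qPoch
      simp only [← pow_mul, mul_add, mul_one]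
    · rw [← pow_mul]; exact pow_eq_zero_of_le_exp hq (Nat.le_mul_of_pos_left _ (by omega))
  -- The additional factor j = C equals 1, so all three products run over the same C + 1 periods.
  have h2 : ∏ j ∈ range C, (1 - q ^ (b + (i + b) * j)) =
      ∏ j ∈ range (C + 1), (1 - q ^ ((i + b) * j + b)) := by
    rw [prod_range_succ _ C, pow_eq_zero_of_le_exp hq (n := (i + b) * C + b) (by nlinarith),
      sub_zero, mul_one]
    simp only [add_comm b]
  have h3 : qPoch q L = ∏ n ∈ range ((i + b) * (C + 1)), (1 - q ^ (n + 1)) :=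
    (qPoch_eq_of_le hq (by omega) (by nlinarith)).symm
  rw [h1, h2, h3, prod_range_mul_eq, prod_range_mul_eq, ← prod_mul_distrib, ← prod_mul_distrib,
    ← prod_mul_distrib]
  refine prod_congr rfl fun j _ => ?_
  have := prod_range_eq_of_not_allowed hi (show i < b by omega)
    (fun r => 1 - q ^ ((i + b) * j + r))
  simp only [add_assoc] at this ⊢
  rw [this, add_comm ((i + (b : ℕ)) * j) i]
  congr 1
  refine prod_congr rfl fun r _ => ?_
  simp only [Allowed, Nat.mul_add_mod]

/-! ### Generating functions of partitions -/

/-- Partitions with parts in `{N + 1, …, N + s}` in which the multiplicity of `n` is less than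
`bd n x`, where `x` is the initial state for `n = N + 1` and is `nx c` if `n - 1` has
multiplicity `c`. -/
def levelPartitions (bd : ℕ → ℕ → ℕ) (nx : ℕ → ℕ) : ℕ → ℕ → ℕ → Finset (Multiset ℕ)
  | 0, _, _ => {0}
  | s + 1, N, x => (range (bd (N + 1) x)).biUnion fun c =>
      (levelPartitions bd nx s (N + 1) (nx c)).image (Multiset.replicate c (N + 1) + ·)

theorem mem_levelPartitions_succ {bd : ℕ → ℕ → ℕ} {nx : ℕ → ℕ} {s N x : ℕ} {lam : Multiset ℕ} :
    lam ∈ levelPartitions bd nx (s + 1) N x ↔ ∃ c < bd (N + 1) x,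
      ∃ mu ∈ levelPartitions bd nx s (N + 1) (nx c), Multiset.replicate c (N + 1) + mu = lam := by
  simp [levelPartitions]

theorem bounds_of_mem_levelPartitions {bd : ℕ → ℕ → ℕ} {nx : ℕ → ℕ} {s N x : ℕ}
    {lam : Multiset ℕ} (h : lam ∈ levelPartitions bd nx s N x) : ∀ n ∈ lam, N < n ∧ n ≤ N + s := by
  induction s generalizing N x lam with
  | zero => simp [levelPartitions] at h; simp [h]
  | succ s ih =>
    obtain ⟨c, -, mu, hmu, rfl⟩ := mem_levelPartitions_succ.1 h
    intro n hn
    rcases Multiset.mem_add.1 hn with hn | hn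
    · have := Multiset.eq_of_mem_replicate hn; omega
    · have := ih hmu n hn; omega

theorem count_of_mem_levelPartitions {bd : ℕ → ℕ → ℕ} {nx : ℕ → ℕ} {s N x : ℕ}
    {lam : Multiset ℕ} (h : lam ∈ levelPartitions bd nx s N x) {n : ℕ} (hn : n ≤ N) :
    lam.count n = 0 := by
  rw [Multiset.count_eq_zero]
  intro hm
  have := bounds_of_mem_levelPartitions h n hm
  omega

/-- All remaining parts exceed N + 1, so the multiplicity c of N + 1 can be read off and the union
over c is disjoint. -/
theorem sum_levelPartitions_succ (q : R) (bd : ℕ → ℕ → ℕ) (nx : ℕ → ℕ)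
    (s N x : ℕ) : ∑ lam ∈ levelPartitions bd nx (s + 1) N x, q ^ lam.sum =
      ∑ c ∈ range (bd (N + 1) x), q ^ ((N + 1) * c) *
        ∑ lam ∈ levelPartitions bd nx s (N + 1) (nx c), q ^ lam.sum := by
  rw [levelPartitions, sum_biUnion]
  · refine sum_congr rfl fun c _ => ?_
    rw [sum_image fun _ _ _ _ h => add_left_cancel h, mul_sum]
    refine sum_congr rfl fun mu _ => ?_
    rw [Multiset.sum_add, Multiset.sum_replicate, pow_add, smul_eq_mul, mul_comm c]
  · intro c _ c' _ hcc
    refine disjoint_left.2 fun lam h h' => hcc ?_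
    obtain ⟨mu, hmu, rfl⟩ := mem_image.1 h
    obtain ⟨mu', hmu', h'⟩ := mem_image.1 h'
    have := congrArg (Multiset.count (N + 1)) h'
    simp only [Multiset.count_add, Multiset.count_replicate_self,
      count_of_mem_levelPartitions hmu le_rfl, count_of_mem_levelPartitions hmu' le_rfl] at this
    omega

theorem qPoch_mul_sum_gordon {q : R} {L C : ℕ} (hq : q ^ L = 0)
    (hC : L ≤ C) (hC0 : 0 < C) {s N i : ℕ} (d : ℕ) (hi : 0 < i) (hs : L ≤ N + s + 1) :
    qPoch q L * ∑ lam ∈ levelPartitions (fun _ x => x) (fun c => i + d - c) s N i, q ^ lam.sum =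
      gordonSum q C i d N := by
  obtain ⟨k, hk⟩ : ∃ k, k = i + d := ⟨_, rfl⟩
  rw [← hk]
  induction s generalizing N i d with
  | zero => rw [gordonSum_of_le hq hC0 hi d hs]; simp [levelPartitions]
  | succ s ih =>
    rw [sum_levelPartitions_succ, gordonSum_eq_sum hq hC, mul_sum]
    refine sum_congr rfl fun c hc => ?_
    rw [mem_range] at hc
    rw [← hk, ← ih (i := k - c) c (by omega) (by omega) (by omega)]
    ring

/-- Bounding multiplicities by L costs nothing: as (q^n)^L = 0, the truncated geometric series is
already the inverse of 1 - q^n. -/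
theorem sum_allowed_mul_prod {q : R} {L : ℕ} (hq : q ^ L = 0)
    (P : ℕ → Prop) [DecidablePred P] (s N x : ℕ) (nx : ℕ → ℕ) :
    (∑ lam ∈ levelPartitions (fun n _ => if P n then L else 1) nx s N x, q ^ lam.sum) *
      ∏ j ∈ range s, (if P (N + j + 1) then 1 - q ^ (N + j + 1) else 1) = 1 := by
  induction s generalizing N x with
  | zero => simp [levelPartitions]
  | succ s ih =>
    rw [sum_levelPartitions_succ, prod_range_succ', sum_mul]
    have h1 : ∀ c ∈ range (if P (N + 1) then L else 1), q ^ ((N + 1) * c) *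
        (∑ lam ∈ levelPartitions (fun n _ => if P n then L else 1) nx s (N + 1) (nx c),
          q ^ lam.sum) * ((∏ j ∈ range s,
          (if P (N + (j + 1) + 1) then 1 - q ^ (N + (j + 1) + 1) else 1)) *
          (if P (N + 0 + 1) then 1 - q ^ (N + 0 + 1) else 1)) = (q ^ (N + 1)) ^ c *
          (if P (N + 1) then 1 - q ^ (N + 1) else 1) := by
      intro c _
      have := ih (N + 1) (nx c)
      simp only [show ∀ j, N + 1 + j + 1 = N + (j + 1) + 1 from fun j => by ring] at this
      rw [add_zero, pow_mul]
      linear_combination (q ^ (N + 1)) ^ c * (if P (N + 1) then 1 - q ^ (N + 1) else 1) * this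
    rw [sum_congr rfl h1, ← sum_mul]
    split_ifs
    · have : (q ^ (N + 1)) ^ L = 0 := by
        rw [← pow_mul]; exact pow_eq_zero_of_le_exp hq (Nat.le_mul_of_pos_left _ N.succ_pos)
      rw [geom_sum_mul_neg, this, sub_zero]
    · simp

theorem mem_levelPartitions_allowed {L s N x : ℕ} {nx : ℕ → ℕ} (hL : 0 < L) {P : ℕ → Prop}
    [DecidablePred P] {lam : Multiset ℕ} :
    lam ∈ levelPartitions (fun n _ => if P n then L else 1) nx s N x ↔
      (∀ n ∈ lam, N < n ∧ n ≤ N + s ∧ P n) ∧ ∀ n, lam.count n < L := by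
  induction s generalizing N x lam with
  | zero =>
    simp only [levelPartitions, mem_singleton]
    constructor
    · rintro rfl; simpa using hL
    · rintro ⟨h, -⟩
      refine Multiset.eq_zero_of_forall_notMem fun n hn => ?_
      have := h n hn
      omega
  | succ s ih =>
    rw [mem_levelPartitions_succ]
    constructor
    · rintro ⟨c, hc, mu, hmu, rfl⟩
      have h0 := count_of_mem_levelPartitions hmu le_rfl
      obtain ⟨h1, h2⟩ := ih.1 hmu
      refine ⟨fun n hn => ?_, fun n => ?_⟩
      · rcases Multiset.mem_add.1 hn with hn | hn
        · obtain ⟨hc0, rfl⟩ := Multiset.mem_replicate.1 hn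
          refine ⟨by omega, by omega, ?_⟩
          by_contra hP
          rw [if_neg hP] at hc
          omega
        · have := h1 n hn
          exact ⟨by omega, by omega, this.2.2⟩
      · rw [Multiset.count_add, Multiset.count_replicate]
        split_ifs with h
        · subst h
          rw [h0]
          split_ifs at hc <;> omega
        · simpa using h2 n
    · rintro ⟨h1, h2⟩
      refine ⟨lam.count (N + 1), ?_, lam.filter (fun n => ¬ (N + 1 = n)), ih.2 ⟨?_, ?_⟩, ?_⟩
      · split_ifs with hP
        · exact h2 _
        · rw [Nat.lt_one_iff, Multiset.count_eq_zero]
          exact fun h => hP (h1 _ h).2.2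
      · intro n hn
        obtain ⟨hn, hne⟩ := Multiset.mem_filter.1 hn
        have := h1 n hn
        exact ⟨by omega, by omega, this.2.2⟩
      · intro n
        exact (Multiset.count_le_of_le n (Multiset.filter_le _ _)).trans_lt (h2 n)
      · rw [← Multiset.filter_eq, Multiset.filter_add_not]

/-- The state is a strict bound on the next multiplicity; passing from c to k - c encodes that
neighbouring multiplicities add up to less than k. Since c < i ≤ k, the new state is again positive
and at most k. -/
theorem mem_levelPartitions_gordon {k s N i : ℕ} (hi : 0 < i) (hik : i ≤ k) {lam : Multiset ℕ} :
    lam ∈ levelPartitions (fun _ x => x) (fun c => k - c) s N i ↔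
      (∀ n ∈ lam, N < n ∧ n ≤ N + s) ∧ lam.count (N + 1) < i ∧
        ∀ n, N < n → lam.count n + lam.count (n + 1) < k := by
  induction s generalizing N i lam with
  | zero =>
    simp only [levelPartitions, mem_singleton]
    constructor
    · rintro rfl
      simp only [Multiset.notMem_zero, false_imp_iff, implies_true, Multiset.count_zero, true_and]
      exact ⟨hi, fun _ _ => by omega⟩
    · rintro ⟨h, -⟩
      refine Multiset.eq_zero_of_forall_notMem fun n hn => ?_
      have := h n hn
      omega
  | succ s ih =>
    rw [mem_levelPartitions_succ]
    constructor
    · rintro ⟨c, hc, mu, hmu, rfl⟩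
      have h0 := count_of_mem_levelPartitions hmu le_rfl
      obtain ⟨h1, h2, h3⟩ := (ih (by omega) (by omega)).1 hmu
      have h4 := bounds_of_mem_levelPartitions hmu
      refine ⟨fun n hn => ?_, ?_, fun n hn => ?_⟩
      · rcases Multiset.mem_add.1 hn with hn | hn
        · have := Multiset.eq_of_mem_replicate hn; omega
        · have := h1 n hn; omega
      · simpa [h0] using hc
      · simp only [Multiset.count_add, Multiset.count_replicate]
        rw [if_neg (show ¬ N + 1 = n + 1 by omega)]
        split_ifs with h
        · subst h; omega
        · have := h3 n (by omega); omega
    · rintro ⟨h1, h2, h3⟩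
      refine ⟨lam.count (N + 1), h2, lam.filter (fun n => ¬ (N + 1 = n)),
        (ih (by omega) (by omega)).2 ⟨?_, ?_, ?_⟩, ?_⟩
      · intro n hn
        obtain ⟨hn, hne⟩ := Multiset.mem_filter.1 hn
        have := h1 n hn
        omega
      · rw [Multiset.count_filter_of_pos (by omega)]
        have := h3 (N + 1) (by omega)
        omega
      · intro n hn
        rw [Multiset.count_filter_of_pos (by omega), Multiset.count_filter_of_pos (by omega)]
        exact h3 n (by omega)
      · rw [← Multiset.filter_eq, Multiset.filter_add_not]

/-! ### Gordon's theorem for integer partitions -/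

theorem sum_allowed_eq_sum_gordon {q : R} {L i d : ℕ} (hq : q ^ L = 0)
    (hi : 0 < i) :
    ∑ lam ∈ levelPartitions (fun n _ => if Allowed i (i + 2 * d + 1) n then L else 1) id
        ((i + (i + 2 * d + 1)) * (2 * L + 1)) 0 0, q ^ lam.sum =
      ∑ lam ∈ levelPartitions (fun _ x => x) (fun c => i + d - c)
        ((i + (i + 2 * d + 1)) * (2 * L + 1)) 0 i, q ^ lam.sum := by
  have h1 := qPoch_mul_sum_gordon hq (show L ≤ 2 * L + 1 by omega) (by omega)
    (s := (i + (i + 2 * d + 1)) * (2 * L + 1)) (N := 0) d hi (by nlinarith)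
  have h2 := sum_allowed_mul_prod hq (fun n => Allowed i (i + 2 * d + 1) n)
    ((i + (i + 2 * d + 1)) * (2 * L + 1)) 0 0 id
  have h3 := gordonSum_mul_prod hq (d := d) hi (le_refl (2 * L))
  simp only [zero_add] at h2
  apply (isUnit_qPoch ⟨L, hq⟩ L).mul_left_cancel
  rw [h1, ← h3, mul_assoc, mul_comm (∏ _ ∈ _, _), h2, mul_one]

theorem card_filter_sum_eq {S T : Finset (Multiset ℕ)} {L n : ℕ} (hn : n < L)
    (h : ∀ {R : Type} [CommRing R] {q : R}, q ^ L = 0 →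
      ∑ lam ∈ S, q ^ lam.sum = ∑ lam ∈ T, q ^ lam.sum) :
    (S.filter fun lam => lam.sum = n).card = (T.filter fun lam => lam.sum = n).card := by
  let π := Ideal.Quotient.mk (Ideal.span {(Polynomial.X : Polynomial ℤ) ^ L})
  have h1 : π Polynomial.X ^ L = 0 := by
    rw [← map_pow, Ideal.Quotient.eq_zero_iff_mem]
    exact Ideal.mem_span_singleton_self _
  have h2 := h h1
  simp only [← map_pow, ← map_sum] at h2
  rw [Ideal.Quotient.eq, Ideal.mem_span_singleton, Polynomial.X_pow_dvd_iff] at h2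
  have h3 := h2 n hn
  rw [Polynomial.coeff_sub, sub_eq_zero, Polynomial.finsetSum_coeff,
    Polynomial.finsetSum_coeff] at h3
  simp only [Polynomial.coeff_X_pow, sum_boole, eq_comm (a := n)] at h3
  exact_mod_cast h3

/-- Partitions into positive parts not congruent to `0, ± i` modulo `2k + 1`. -/
def AllowedPartition (k i : ℕ) (lam : Multiset ℕ) : Prop :=
  ∀ n ∈ lam, 0 < n ∧ Allowed i (2 * k + 1 - i) n

/-- Gordon partitions, in terms of multiplicities. -/
def GordonPartition (k i : ℕ) (lam : Multiset ℕ) : Prop :=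
  (∀ n ∈ lam, 0 < n) ∧ lam.count 1 < i ∧ ∀ n, 0 < n → lam.count n + lam.count (n + 1) < k

theorem count_le_sum {lam : Multiset ℕ} (h : ∀ n ∈ lam, 0 < n) (m : ℕ) :
    lam.count m ≤ lam.sum :=
  (Multiset.count_le_card _ _).trans (by
    simpa using Multiset.card_nsmul_le_sum (s := lam) (a := 1) h)

/-- Gordon's theorem: equality of the generating functions, coefficient by coefficient. -/
theorem exists_finset_gordon {k i : ℕ} (hi : 1 ≤ i) (hik : i ≤ k) (n : ℕ) :
    ∃ S T : Finset (Multiset ℕ), S.card = T.card ∧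
      (∀ lam, lam ∈ S ↔ AllowedPartition k i lam ∧ lam.sum = n) ∧
      (∀ lam, lam ∈ T ↔ GordonPartition k i lam ∧ lam.sum = n) := by
  obtain ⟨d, rfl⟩ := Nat.exists_eq_add_of_le hik
  have hb : 2 * (i + d) + 1 - i = i + 2 * d + 1 := by omega
  -- With L = n + 1 the largest available part is at least n, so the bound on parts is automatic for
  -- partitions of n.
  have hlarge : n ≤ 0 + (i + (i + 2 * d + 1)) * (2 * (n + 1) + 1) := by nlinarith
  refine ⟨_, _, card_filter_sum_eq n.lt_succ_self fun hq => sum_allowed_eq_sum_gordon (d := d) hq hi,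
    fun lam => ?_, fun lam => ?_⟩
  · rw [mem_filter, mem_levelPartitions_allowed n.succ_pos, AllowedPartition, hb]
    refine and_congr_left fun hs => ⟨fun h m hm => ⟨(h.1 m hm).1, (h.1 m hm).2.2⟩, fun h => ?_⟩
    refine ⟨fun m hm => ⟨(h m hm).1, ?_, (h m hm).2⟩, fun m => ?_⟩
    · exact ((Multiset.le_sum_of_mem hm).trans hs.le).trans hlarge
    · exact Nat.lt_succ_of_le ((count_le_sum (fun m hm => (h m hm).1) m).trans hs.le)
  · rw [mem_filter, mem_levelPartitions_gordon hi hik, GordonPartition]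
    refine and_congr_left fun hs => ⟨fun h => ⟨fun m hm => (h.1 m hm).1, h.2⟩,
      fun h => ⟨fun m hm => ⟨h.1 m hm, ?_⟩, h.2⟩⟩
    exact ((Multiset.le_sum_of_mem hm).trans hs.le).trans hlarge

/-- Gordon's theorem as a size-preserving bijection. -/
theorem exists_equiv_gordon {k i : ℕ} (hi : 1 ≤ i) (hik : i ≤ k) :
    ∃ e : {lam // AllowedPartition k i lam} ≃ {lam // GordonPartition k i lam},
      ∀ lam, (e lam).1.sum = lam.1.sum := by
  have h : ∀ n, Nonempty ({x : {lam // AllowedPartition k i lam} // x.1.sum = n} ≃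
      {x : {lam // GordonPartition k i lam} // x.1.sum = n}) := by
    intro n
    obtain ⟨S, T, hST, hS, hT⟩ := exists_finset_gordon hi hik n
    refine ⟨(Equiv.subtypeSubtypeEquivSubtypeInter (AllowedPartition k i) (·.sum = n)).trans
      (((Equiv.subtypeEquivRight fun lam => (hS lam).symm).trans (equivOfCardEq hST)).trans
      ((Equiv.subtypeEquivRight hT).trans
        (Equiv.subtypeSubtypeEquivSubtypeInter (GordonPartition k i) (·.sum = n)).symm))⟩
  let f := fun n => (h n).some
  refine ⟨(Equiv.sigmaFiberEquiv fun x : {lam // AllowedPartition k i lam} => x.1.sum).symm.trans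
    ((Equiv.sigmaCongrRight f).trans
      (Equiv.sigmaFiberEquiv fun x : {lam // GordonPartition k i lam} => x.1.sum)), fun lam => ?_⟩
  exact (f lam.1.sum ⟨lam, rfl⟩).2

end QSeries

namespace RadialPartition

open NumberField QSeries

/-! ### Gordon's conditions in terms of multiplicities -/

/-- In a nonincreasing list the entries at least t form an initial segment; this translates
positions into multiplicities. -/
theorem le_getElem_iff_lt_countP {b : List ℕ} (hb : b.Pairwise (· ≥ ·)) (t j : ℕ)
    (hj : j < b.length) : t ≤ b[j] ↔ j < b.countP (t ≤ ·) := by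
  induction b generalizing j with
  | nil => simp at hj
  | cons a l ih =>
    rw [List.pairwise_cons] at hb
    by_cases ha : t ≤ a
    · rw [List.countP_cons_of_pos (by simpa using ha)]
      cases j with
      | zero => simpa using ha
      | succ j =>
        rw [List.getElem_cons_succ, ih hb.2 j (by simpa using hj)]
        omega
    · have h0 : (a :: l).countP (t ≤ ·) = 0 := by
        rw [List.countP_eq_zero]
        intro n hn
        rcases List.mem_cons.1 hn with rfl | hn
        · simpa using ha
        · have := hb.1 n hn
          simp only [decide_eq_true_eq]
          omega
      rw [h0]
      simp only [Nat.not_lt_zero, iff_false]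
      cases j with
      | zero => simpa using ha
      | succ j =>
        have := hb.1 _ (List.getElem_mem (l := l) (n := j) (by simpa using hj))
        rw [List.getElem_cons_succ]
        omega

theorem countP_le_eq_add_count (b : List ℕ) (t : ℕ) :
    b.countP (t ≤ ·) = b.countP (t + 1 ≤ ·) + b.count t := by
  induction b with
  | nil => simp
  | cons a l ih =>
    simp only [List.countP_cons, List.count_cons, ih, decide_eq_true_eq, beq_iff_eq]
    split_ifs <;> omega

theorem isGordon_iff {k i : ℕ} (hi : 1 ≤ i) (hik : i ≤ k) {b : List ℕ}
    (hb : b.Pairwise (· ≥ ·)) : IsGordon k i b ↔ GordonPartition k i (b : Multiset ℕ) := by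
  have hcount : ∀ n, b.countP (n ≤ ·) = b.countP (n + 2 ≤ ·) + (b.count n + b.count (n + 1)) := by
    intro n
    rw [countP_le_eq_add_count b n, countP_le_eq_add_count b (n + 1)]
    ring
  have hlen : ∀ n, b.countP (n ≤ ·) ≤ b.length := fun n => List.countP_le_length
  have hone : (∀ n ∈ b, 1 ≤ n) → b.length = b.countP (2 ≤ ·) + b.count 1 := by
    intro h
    rw [← countP_le_eq_add_count b 1, eq_comm, List.countP_eq_length]
    simpa using h
  simp only [GordonPartition, Multiset.mem_coe, Multiset.coe_count]
  constructor
  · intro h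
    refine ⟨h.pos, ?_, fun n _ => ?_⟩
    · have h1 := hone h.pos
      by_contra hc
      have h2 := h.last (b.length - i) (by omega) (by omega)
      rw [le_getElem_iff_lt_countP hb] at h2
      omega
    · by_contra hc
      have h1 := hcount n
      have h2 := hlen n
      -- The first index is that of the first part below n + 2. If n and n + 1 together occurred k
      -- times, the part k - 1 places later would still be at least n.
      have h3 := h.diff (b.countP (n + 2 ≤ ·)) (b.countP (n + 2 ≤ ·) + k - 1)
        (by omega) (by omega) (by omega)
      have h4 := (le_getElem_iff_lt_countP hb n (b.countP (n + 2 ≤ ·) + k - 1) (by omega)).2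
        (by omega)
      have h5 := (le_getElem_iff_lt_countP hb (n + 2) (b.countP (n + 2 ≤ ·)) (by omega)).1
        (by omega)
      omega
  · rintro ⟨hpos, h1, h2⟩
    refine ⟨hpos, hb, fun j l hj hl hjl => ?_, fun j hj hji => ?_⟩
    · rw [le_getElem_iff_lt_countP hb]
      have h3 := (le_getElem_iff_lt_countP hb b[l] l hl).1 le_rfl
      have h4 := h2 b[l] (hpos _ (List.getElem_mem hl))
      have h5 := hcount b[l]
      omega
    · rw [le_getElem_iff_lt_countP hb]
      have := hone hpos
      omega

theorem gordonPartition_zero {k i : ℕ} (hi : 1 ≤ i) (hik : i ≤ k) : GordonPartition k i 0 :=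
  ⟨by simp, by rw [Multiset.count_zero]; omega, fun _ _ => by simp only [Multiset.count_zero]; omega⟩

/-! ### Sections of a partition -/

section Sections

variable {K : Type*} [Field K]

/-- The multiple `n γ` for `n > 0`. -/
noncomputable def nmul (n : ℕ) (γ : TotPos K) : TotPos K :=
  if h : 0 < n then ⟨(n : 𝓞 K) * γ.1, fun φ => by
    simpa using mul_pos (show (0 : ℝ) < n by exact_mod_cast h) (γ.2 φ)⟩ else γ

theorem nmul_val {n : ℕ} (h : 0 < n) (γ : TotPos K) : (nmul n γ).1 = (n : 𝓞 K) * γ.1 :=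
  congrArg (fun x : TotPos K => x.1) (dif_pos h)

theorem TotPos.ext {x y : TotPos K} (h : x.1 = y.1) : x = y := Subtype.ext h

theorem map_val_map_nmul {m : Multiset ℕ} (hm : ∀ n ∈ m, 0 < n) (γ : TotPos K) :
    (m.map (nmul · γ)).map Subtype.val = m.map fun n : ℕ => (n : 𝓞 K) * γ.1 :=
  (Multiset.map_map _ _ _).trans (Multiset.map_congr rfl fun n hn => nmul_val (hm n hn) γ)

theorem sum_map_nmul {m : Multiset ℕ} (hm : ∀ n ∈ m, 0 < n) (γ : TotPos K) :
    ((m.map (nmul · γ)).map Subtype.val).sum = (m.sum : 𝓞 K) * γ.1 := by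
  rw [map_val_map_nmul hm, Multiset.sum_map_mul_right, Nat.cast_multiset_sum]

variable [NumberField K] [IsTotallyReal K]

theorem scale_pos (δ : TotPos K) : 0 < scale δ := (existsUnique_scale δ).choose_spec.1.1

theorem exists_primitive (δ : TotPos K) :
    ∃ γ : TotPos K, IsPrimitive γ ∧ δ.1 = (scale δ : 𝓞 K) * γ.1 :=
  (existsUnique_scale δ).choose_spec.1.2

/-- The primitive `γ` with `δ = s(δ) γ`. -/
noncomputable def primPart (δ : TotPos K) : TotPos K := (exists_primitive δ).choose

theorem isPrimitive_primPart (δ : TotPos K) : IsPrimitive (primPart δ) :=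
  (exists_primitive δ).choose_spec.1

theorem nmul_scale_primPart (δ : TotPos K) : nmul (scale δ) (primPart δ) = δ :=
  TotPos.ext ((nmul_val (scale_pos δ) _).trans (exists_primitive δ).choose_spec.2.symm)

theorem scale_nmul {n : ℕ} (hn : 0 < n) {γ : TotPos K} (hγ : IsPrimitive γ) :
    scale (nmul n γ) = n :=
  (existsUnique_scale (nmul n γ)).unique ⟨scale_pos _, exists_primitive _⟩
    ⟨hn, γ, hγ, nmul_val hn γ⟩

theorem primPart_nmul {n : ℕ} (hn : 0 < n) {γ : TotPos K} (hγ : IsPrimitive γ) :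
    primPart (nmul n γ) = γ := by
  have h := congrArg Subtype.val (nmul_scale_primPart (nmul n γ))
  rw [scale_nmul hn hγ] at h
  have h2 : (n : 𝓞 K) * (primPart (nmul n γ)).1 = (n : 𝓞 K) * γ.1 :=
    (nmul_val hn _).symm.trans (h.trans (nmul_val hn γ))
  exact TotPos.ext (mul_left_cancel₀ (by exact_mod_cast hn.ne') h2)

open Classical in
/-- The scales of the parts of `lam` in the `γ`-section. -/
noncomputable def sec (γ : TotPos K) : Multiset (TotPos K) →+ Multiset ℕ :=
  (Multiset.mapAddMonoidHom scale).comp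
    { toFun := Multiset.filter (primPart · = γ)
      map_zero' := Multiset.filter_zero _
      map_add' := Multiset.filter_add _ }

open Classical in
theorem sec_apply (γ : TotPos K) (lam : Multiset (TotPos K)) :
    sec γ lam = (lam.filter (primPart · = γ)).map scale := rfl

theorem mem_sec {γ : TotPos K} {lam : Multiset (TotPos K)} {n : ℕ} :
    n ∈ sec γ lam ↔ ∃ x ∈ lam, primPart x = γ ∧ scale x = n := by
  simp [sec_apply, and_assoc]

open Classical in
theorem sec_map_nmul {m : Multiset ℕ} (hm : ∀ n ∈ m, 0 < n) {γ' : TotPos K} (hγ : IsPrimitive γ')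
    (γ : TotPos K) : sec γ (m.map (nmul · γ')) = if γ' = γ then m else 0 := by
  rw [sec_apply]
  split_ifs with h
  · subst h
    rw [Multiset.filter_eq_self.2, Multiset.map_map]
    · exact (Multiset.map_congr rfl fun n hn => scale_nmul (hm n hn) hγ).trans (Multiset.map_id m)
    · intro x hx
      obtain ⟨n, hn, rfl⟩ := Multiset.mem_map.1 hx
      exact primPart_nmul (hm n hn) hγ
  · rw [Multiset.filter_eq_nil.2, Multiset.map_zero]
    intro x hx
    obtain ⟨n, hn, rfl⟩ := Multiset.mem_map.1 hx
    rwa [primPart_nmul (hm n hn) hγ]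

open Classical in
/-- The primitive directions of the parts of `lam`. -/
noncomputable def directions (lam : Multiset (TotPos K)) : Finset (TotPos K) :=
  (lam.map primPart).toFinset

theorem mem_directions {γ : TotPos K} {lam : Multiset (TotPos K)} :
    γ ∈ directions lam ↔ ∃ x ∈ lam, primPart x = γ := by
  simp [directions]

theorem isPrimitive_of_mem_directions {γ : TotPos K} {lam : Multiset (TotPos K)}
    (h : γ ∈ directions lam) : IsPrimitive γ := by
  obtain ⟨x, -, rfl⟩ := mem_directions.1 h
  exact isPrimitive_primPart x

theorem mem_directions_iff_sec_ne_zero {γ : TotPos K} {lam : Multiset (TotPos K)} :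
    γ ∈ directions lam ↔ sec γ lam ≠ 0 := by
  rw [mem_directions]
  constructor
  · rintro ⟨x, hx, h⟩ h0
    have : scale x ∈ sec γ lam := mem_sec.2 ⟨x, hx, h, rfl⟩
    simp [h0] at this
  · intro h
    obtain ⟨n, hn⟩ := Multiset.exists_mem_of_ne_zero h
    obtain ⟨x, hx, h, -⟩ := mem_sec.1 hn
    exact ⟨x, hx, h⟩

theorem pos_of_mem_sec {γ : TotPos K} {lam : Multiset (TotPos K)} {n : ℕ} (h : n ∈ sec γ lam) :
    0 < n := by
  obtain ⟨x, -, -, rfl⟩ := mem_sec.1 h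
  exact scale_pos x

/-- A partition is the concatenation of its sections. -/
theorem sum_sec (lam : Multiset (TotPos K)) :
    ∑ γ ∈ directions lam, (sec γ lam).map (nmul · γ) = lam := by
  classical
  have h : ∀ γ ∈ directions lam, (sec γ lam).map (nmul · γ) = lam.filter (primPart · = γ) := by
    intro γ _
    rw [sec_apply, Multiset.map_map]
    refine (Multiset.map_congr rfl fun x hx => ?_).trans (Multiset.map_id _)
    obtain ⟨-, rfl⟩ := Multiset.mem_filter.1 hx
    exact nmul_scale_primPart x
  rw [Finset.sum_congr rfl h]
  ext x
  simp only [Multiset.count_sum', Multiset.count_filter]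
  rw [Finset.sum_ite_eq]
  split_ifs with hx
  · rfl
  · rw [eq_comm, Multiset.count_eq_zero]
    exact fun hm => hx (mem_directions.2 ⟨x, hm, rfl⟩)

theorem eq_of_sec_eq {lam mu : Multiset (TotPos K)} (h : ∀ γ, sec γ lam = sec γ mu) :
    lam = mu := by
  have hd : directions lam = directions mu := by
    ext γ
    rw [mem_directions_iff_sec_ne_zero, mem_directions_iff_sec_ne_zero, h]
  rw [← sum_sec lam, ← sum_sec mu, hd]
  exact Finset.sum_congr rfl fun γ _ => by rw [h]

/-- Apply a map of integer partitions in each section. -/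
noncomputable def sectionMap (E : Multiset ℕ → Multiset ℕ) (lam : Multiset (TotPos K)) :
    Multiset (TotPos K) :=
  ∑ γ ∈ directions lam, (E (sec γ lam)).map (nmul · γ)

/-- `sectionMap` only visits directions occurring in `lam`; `E 0 = 0` makes the formula true in the
others. -/
theorem sec_sectionMap {E : Multiset ℕ → Multiset ℕ} (h0 : E 0 = 0) {lam : Multiset (TotPos K)}
    (hE : ∀ γ, ∀ n ∈ E (sec γ lam), 0 < n) (γ : TotPos K) :
    sec γ (sectionMap E lam) = E (sec γ lam) := by
  classical
  rw [sectionMap, map_sum, Finset.sum_congr rfl fun γ' h =>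
    sec_map_nmul (hE γ') (isPrimitive_of_mem_directions h) γ, Finset.sum_ite_eq']
  split_ifs with h
  · rfl
  · rw [mem_directions_iff_sec_ne_zero, not_not] at h
    rw [h, h0]

theorem sum_sectionMap {E : Multiset ℕ → Multiset ℕ} {lam : Multiset (TotPos K)}
    (hE : ∀ γ, ∀ n ∈ E (sec γ lam), 0 < n) (hs : ∀ γ, (E (sec γ lam)).sum = (sec γ lam).sum) :
    ((sectionMap E lam).map Subtype.val).sum = (lam.map Subtype.val).sum := by
  conv_rhs => rw [← sum_sec lam]
  have h : ∀ F : TotPos K → Multiset (TotPos K),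
      ((∑ γ ∈ directions lam, F γ).map Subtype.val).sum =
        ∑ γ ∈ directions lam, ((F γ).map Subtype.val).sum := fun F =>
    map_sum ((Multiset.sumAddMonoidHom (M := 𝓞 K)).comp
      (Multiset.mapAddMonoidHom (Subtype.val : TotPos K → 𝓞 K))) F _
  rw [sectionMap, h, h]
  refine Finset.sum_congr rfl fun γ _ => ?_
  rw [sum_map_nmul (hE γ), sum_map_nmul (fun n hn => pos_of_mem_sec hn), hs]

end Sections

section Gluing

variable {K : Type*} [Field K]

/-! ### Finiteness -/

theorem map_sum_eq_of_isPartitionOf {lam : Multiset (TotPos K)} {δ : TotPos K}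
    (h : IsPartitionOf lam δ) (φ : K →+* ℝ) :
    (lam.map fun x : TotPos K => φ (x.1 : K)).sum = φ (δ.1 : K) := by
  unfold IsPartitionOf at h
  have := map_multiset_sum (φ.comp (algebraMap (𝓞 K) K)) (lam.map fun x : TotPos K => x.1)
  rw [Multiset.map_map] at this
  exact this.symm.trans (congrArg (fun x : 𝓞 K => φ (x : K)) h)

theorem count_mul_le_of_isPartitionOf {lam : Multiset (TotPos K)} {δ : TotPos K}
    (h : IsPartitionOf lam δ) (φ : K →+* ℝ) {x : TotPos K} {c : ℕ}
    (hc : Multiset.replicate c x ≤ lam) : c * φ (x.1 : K) ≤ φ (δ.1 : K) := by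
  obtain ⟨mu, rfl⟩ := Multiset.le_iff_exists_add.1 hc
  rw [← map_sum_eq_of_isPartitionOf h φ, Multiset.map_add, Multiset.sum_add,
    Multiset.map_replicate, Multiset.sum_replicate, nsmul_eq_mul]
  refine le_add_of_nonneg_right (Multiset.sum_nonneg fun y hy => ?_)
  obtain ⟨z, -, rfl⟩ := Multiset.mem_map.1 hy
  exact (z.2 φ).le

/-- A nonempty sum of totally positive elements is totally positive. The empty partition has sum 0,
hence the condition `lam ≠ 0` in `mem_sectionalB`. -/
theorem allPartitions_of_ne_zero {lam : Multiset (TotPos K)} (h : lam ≠ 0) :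
    lam ∈ allPartitions K := by
  refine ⟨⟨(lam.map fun x : TotPos K => x.1).sum, fun φ => ?_⟩, rfl⟩
  obtain ⟨x, hx⟩ := Multiset.exists_mem_of_ne_zero h
  obtain ⟨mu, rfl⟩ := Multiset.exists_cons_of_mem hx
  have hmu : 0 ≤ φ (((mu.map fun x : TotPos K => x.1).sum : 𝓞 K) : K) := by
    have := map_multiset_sum (φ.comp (algebraMap (𝓞 K) K)) (mu.map fun x : TotPos K => x.1)
    refine le_of_le_of_eq (Multiset.sum_nonneg fun y hy => ?_) this.symm
    obtain ⟨z, hz, rfl⟩ := Multiset.mem_map.1 hy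
    obtain ⟨w, -, rfl⟩ := Multiset.mem_map.1 hz
    exact (w.2 φ).le
  simp only [Multiset.map_cons, Multiset.sum_cons, map_add]
  exact add_pos_of_pos_of_nonneg (x.2 φ) hmu

theorem exists_real_embedding [IsTotallyReal K] (φ : K →+* ℂ) : ∃ ψ : K →+* ℝ, ∀ x, ((ψ x : ℝ) : ℂ) = φ x := by
  have h := IsTotallyReal.complexEmbedding_isReal φ
  exact ⟨h.embedding, fun x => h.coe_embedding_apply x⟩

variable [NumberField K] [IsTotallyReal K]

theorem finite_totPos_le (δ : TotPos K) :
    {x : TotPos K | ∀ φ : K →+* ℝ, φ (x.1 : K) ≤ φ (δ.1 : K)}.Finite := by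
  -- The sum of the absolute values of all conjugates of `δ` bounds every conjugate of `x` at once.
  have h := Embeddings.finite_of_norm_le K ℂ (∑ φ : K →+* ℂ, ‖φ (δ.1 : K)‖)
  refine Set.Finite.of_finite_image (f := fun x : TotPos K => (x.1 : K)) (h.subset ?_) ?_
  · rintro _ ⟨x, hx, rfl⟩
    refine ⟨x.1.2, fun φ => ?_⟩
    refine le_trans ?_ (Finset.single_le_sum (fun φ _ => norm_nonneg _) (Finset.mem_univ φ))
    obtain ⟨ψ, hψ⟩ := exists_real_embedding φ
    simp only [← hψ, Complex.norm_real, Real.norm_eq_abs, abs_of_pos (x.2 ψ), abs_of_pos (δ.2 ψ)]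
    exact hx ψ
  · intro x _ y _ hxy
    exact TotPos.ext (RingOfIntegers.ext hxy)

theorem finite_isPartitionOf (δ : TotPos K) : {lam | IsPartitionOf lam δ}.Finite := by
  classical
  obtain ⟨φ⟩ : Nonempty (K →+* ℂ) := inferInstance
  obtain ⟨ψ, -⟩ := exists_real_embedding φ
  set P := (finite_totPos_le δ).toFinset with hP
  -- One real embedding bounds the multiplicity of each possible part, so every partition of `δ` is
  -- contained in a single multiset.
  refine ((∑ x ∈ P, Multiset.replicate ⌊ψ (δ.1 : K) / ψ (x.1 : K)⌋₊ x).powerset.toFinset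
    |>.finite_toSet).subset fun lam (hlam : IsPartitionOf lam δ) => ?_
  rw [Finset.mem_coe, Multiset.mem_toFinset, Multiset.mem_powerset, Multiset.le_iff_count]
  intro x
  simp only [Multiset.count_sum', Multiset.count_replicate]
  rw [Finset.sum_ite_eq']
  split_ifs with hx
  · rw [Nat.le_floor_iff (div_pos (δ.2 ψ) (x.2 ψ)).le, le_div_iff₀ (x.2 ψ)]
    exact count_mul_le_of_isPartitionOf hlam ψ (Multiset.le_count_iff_replicate_le.1 le_rfl)
  · rw [Nat.le_zero, Multiset.count_eq_zero]
    refine fun hm => hx ?_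
    rw [hP, Set.Finite.mem_toFinset]
    intro φ
    simpa using count_mul_le_of_isPartitionOf hlam φ (c := 1) (x := x) (by simpa using hm)

/-! ### The two classes of partitions in terms of sections -/

theorem allowed_iff_modEq {k i : ℕ} (hi : 1 ≤ i) (hik : i ≤ k) (n : ℕ) :
    Allowed i (2 * k + 1 - i) n ↔ ¬ (n : ℤ) ≡ 0 [ZMOD 2 * k + 1] ∧
      ¬ (n : ℤ) ≡ i [ZMOD 2 * k + 1] ∧ ¬ (n : ℤ) ≡ -i [ZMOD 2 * k + 1] := by
  have h1 : (i : ℤ) % (2 * k + 1) = i := Int.emod_eq_of_lt (by omega) (by omega)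
  have h2 : (-(i : ℤ)) % (2 * k + 1) = ((2 * k + 1 - i : ℕ) : ℤ) := by
    rw [← Int.add_emod_right, Int.emod_eq_of_lt (by omega) (by omega)]
    omega
  have h3 : (n : ℤ) % (2 * k + 1) = ((n % (2 * k + 1) : ℕ) : ℤ) := by push_cast; rfl
  simp only [Int.ModEq, h1, h2, h3, Int.zero_emod, Allowed]
  rw [show i + (2 * k + 1 - i) = 2 * k + 1 by omega]
  simp only [Nat.cast_inj, Nat.cast_eq_zero, ne_eq]

theorem mem_partitionsIn_setA {k i : ℕ} (hi : 1 ≤ i) (hik : i ≤ k) {δ : TotPos K}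
    {lam : Multiset (TotPos K)} : lam ∈ partitionsIn (setA K k i) δ ↔
      IsPartitionOf lam δ ∧ ∀ γ, AllowedPartition k i (sec γ lam) := by
  constructor
  · rintro ⟨⟨-, h⟩, hδ⟩
    refine ⟨hδ, fun γ n hn => ⟨pos_of_mem_sec hn, ?_⟩⟩
    obtain ⟨x, hx, -, rfl⟩ := mem_sec.1 hn
    exact (allowed_iff_modEq hi hik _).2 (h x hx)
  · rintro ⟨hδ, h⟩
    exact ⟨⟨⟨δ, hδ⟩, fun x hx => (allowed_iff_modEq hi hik _).1
      (h (primPart x) _ (mem_sec.2 ⟨x, hx, rfl, rfl⟩)).2⟩, hδ⟩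

theorem mem_sectionalB {k i : ℕ} (hi : 1 ≤ i) (hik : i ≤ k) {γ : TotPos K}
    {lam : Multiset (TotPos K)} : lam ∈ sectionalB k i γ ↔
      lam ≠ 0 ∧ ∃ m, GordonPartition k i m ∧ lam = m.map (nmul · γ) := by
  have hval : ∀ {m : Multiset ℕ}, (∀ n ∈ m, 0 < n) →
      (lam.map Subtype.val = m.map (fun n : ℕ => (n : 𝓞 K) * γ.1) ↔ lam = m.map (nmul · γ)) := by
    intro m hm
    rw [← map_val_map_nmul hm]
    exact (Multiset.map_injective Subtype.val_injective).eq_iff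
  constructor
  · rintro ⟨⟨δ, hδ⟩, b, hb, h⟩
    have hb' := (isGordon_iff hi hik hb.antitone).1 hb
    refine ⟨?_, b, hb', (hval hb'.1).1 h⟩
    rintro rfl
    exact δ.ne_zero hδ.symm
  · rintro ⟨h0, m, hm, h⟩
    have hs : ((m.sort (· ≥ ·) : List ℕ) : Multiset ℕ) = m := Multiset.sort_eq _ _
    refine ⟨allPartitions_of_ne_zero h0, m.sort (· ≥ ·),
      (isGordon_iff hi hik (Multiset.pairwise_sort _ _)).2 (by rwa [hs]), ?_⟩
    rw [← Multiset.map_coe, hs]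
    exact (hval hm.1).2 h

theorem mem_partitionsIn_setB {k i : ℕ} (hi : 1 ≤ i) (hik : i ≤ k) {δ : TotPos K}
    {lam : Multiset (TotPos K)} : lam ∈ partitionsIn (setB K k i) δ ↔
      IsPartitionOf lam δ ∧ ∀ γ, GordonPartition k i (sec γ lam) := by
  classical
  constructor
  · rintro ⟨⟨-, l, g, mu, hg, hprim, hmu, rfl⟩, hδ⟩
    refine ⟨hδ, fun γ => ?_⟩
    choose m hm hmm using fun h => ((mem_sectionalB hi hik).1 (hmu h)).2
    rw [map_sum, Finset.sum_congr rfl fun h _ => by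
      rw [hmm h, sec_map_nmul (hm h).1 (hprim h) γ]]
    by_cases hγ : ∃ h, g h = γ
    · obtain ⟨h, rfl⟩ := hγ
      simpa [hg.eq_iff] using hm h
    · push Not at hγ
      simpa [hγ] using gordonPartition_zero hi hik
  · rintro ⟨hδ, h⟩
    -- The witnesses are the directions of `lam`, enumerated, with their sections; these are
    -- nonempty, as `mem_sectionalB` requires.
    refine ⟨⟨⟨δ, hδ⟩, _, fun j => ((directions lam).equivFin.symm j).1,
      fun j => (sec ((directions lam).equivFin.symm j).1 lam).map
        (nmul · ((directions lam).equivFin.symm j).1), ?_, ?_, ?_, ?_⟩, hδ⟩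
    · exact Subtype.val_injective.comp (Equiv.injective _)
    · exact fun j => isPrimitive_of_mem_directions ((directions lam).equivFin.symm j).2
    · intro j
      refine (mem_sectionalB hi hik).2 ⟨?_, _, h _, rfl⟩
      rw [Ne, Multiset.map_eq_zero]
      exact mem_directions_iff_sec_ne_zero.1 ((directions lam).equivFin.symm j).2
    · rw [Equiv.sum_comp (directions lam).equivFin.symm
        (fun γ => (sec γ.1 lam).map (nmul · γ.1)), Finset.sum_coe_sort (directions lam)
        (fun γ => (sec γ lam).map (nmul · γ)), sum_sec]

/-! ### Transfer of the bijection to partitions of totally positive integers -/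

/-- A size-preserving bijection between two classes of integer partitions, applied in every
section. -/
theorem ncard_eq_of_equiv {P Q : Multiset ℕ → Prop} (e : {m // P m} ≃ {m // Q m})
    (hs : ∀ m, (e m).1.sum = m.1.sum) (hP : ∀ m, P m → ∀ n ∈ m, 0 < n)
    (hQ : ∀ m, Q m → ∀ n ∈ m, 0 < n) (δ : TotPos K) :
    {lam : Multiset (TotPos K) | IsPartitionOf lam δ ∧ ∀ γ, P (sec γ lam)}.ncard =
      {lam : Multiset (TotPos K) | IsPartitionOf lam δ ∧ ∀ γ, Q (sec γ lam)}.ncard := by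
  classical
  have extend : ∀ {P Q : Multiset ℕ → Prop} (e : {m // P m} ≃ {m // Q m}),
      (∀ m, (e m).1.sum = m.1.sum) → (∀ m, Q m → ∀ n ∈ m, 0 < n) →
      ∃ E : Multiset ℕ → Multiset ℕ, E 0 = 0 ∧ ∀ m (h : P m), E m = (e ⟨m, h⟩).1 := by
    intro P Q e hs hQ
    refine ⟨fun m => if h : P m then (e ⟨m, h⟩).1 else 0, ?_, fun m h => dif_pos h⟩
    dsimp only
    split_ifs with h
    -- Preservation of size makes the image of the empty partition have sum 0, and with positive
    -- parts it must be empty.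
    · refine Multiset.eq_zero_of_forall_notMem fun n hn => ?_
      have h1 := hQ _ (e ⟨0, h⟩).2 n hn
      have h2 := Multiset.le_sum_of_mem hn
      rw [hs, Multiset.sum_zero] at h2
      omega
    · rfl
  have hs' : ∀ m, (e.symm m).1.sum = m.1.sum := fun m => by rw [← hs, e.apply_symm_apply]
  obtain ⟨E, hE0, hE⟩ := extend e hs hQ
  obtain ⟨F, hF0, hF⟩ := extend e.symm hs' hP
  -- Stated for an arbitrary bijection so that it serves both `e` and `e.symm`.
  have main : ∀ {P Q : Multiset ℕ → Prop} (e : {m // P m} ≃ {m // Q m})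
      (E : Multiset ℕ → Multiset ℕ), (∀ m, (e m).1.sum = m.1.sum) →
      (∀ m, Q m → ∀ n ∈ m, 0 < n) → E 0 = 0 → (∀ m (h : P m), E m = (e ⟨m, h⟩).1) →
      ∀ lam : Multiset (TotPos K), IsPartitionOf lam δ → (∀ γ, P (sec γ lam)) →
      IsPartitionOf (sectionMap E lam) δ ∧
        ∀ γ, ∃ h : P (sec γ lam), sec γ (sectionMap E lam) = (e ⟨sec γ lam, h⟩).1 := by
    intro P Q e E hs hQ hE0 hE lam hδ hlam
    have hpos : ∀ γ, ∀ n ∈ E (sec γ lam), 0 < n := fun γ => by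
      rw [hE _ (hlam γ)]; exact hQ _ (e _).2
    refine ⟨(sum_sectionMap hpos fun γ => ?_).trans hδ, fun γ => ⟨hlam γ, ?_⟩⟩
    · rw [hE _ (hlam γ), hs]
    · rw [sec_sectionMap hE0 hpos, hE _ (hlam γ)]
  have hmapsE := main e E hs hQ hE0 hE
  have hmapsF := main e.symm F hs' hP hF0 hF
  refine Set.ncard_congr (fun lam _ => sectionMap E lam) ?_ ?_ ?_
  · rintro lam ⟨hδ, hlam⟩
    obtain ⟨h1, h2⟩ := hmapsE lam hδ hlam
    exact ⟨h1, fun γ => by obtain ⟨h, h3⟩ := h2 γ; rw [h3]; exact (e _).2⟩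
  · rintro lam mu ⟨hδ, hlam⟩ ⟨hδ', hmu⟩ heq
    refine eq_of_sec_eq fun γ => ?_
    obtain ⟨_, h1⟩ := (hmapsE lam hδ hlam).2 γ
    obtain ⟨_, h2⟩ := (hmapsE mu hδ' hmu).2 γ
    rw [heq, h2] at h1
    exact (congrArg Subtype.val (e.injective (Subtype.ext h1))).symm
  · rintro mu ⟨hδ, hmu⟩
    obtain ⟨h1, h2⟩ := hmapsF mu hδ hmu
    have h3 : ∀ γ, P (sec γ (sectionMap F mu)) := fun γ => by
      obtain ⟨h, h3⟩ := h2 γ; rw [h3]; exact (e.symm _).2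
    refine ⟨sectionMap F mu, ⟨h1, h3⟩, eq_of_sec_eq fun γ => ?_⟩
    obtain ⟨h4, h5⟩ := (hmapsE _ h1 h3).2 γ
    obtain ⟨h6, h7⟩ := h2 γ
    simp only [h7, Subtype.coe_eta, Equiv.apply_symm_apply] at h5
    exact h5

end Gluing

end RadialPartition

theorem mainTheorem2 (K : Type*) [Field K] [NumberField K] [NumberField.IsTotallyReal K]
    (k i : ℕ) (hi : 1 ≤ i) (hik : i ≤ k) (δ : RadialPartition.TotPos K) :
    (RadialPartition.partitionsIn (RadialPartition.setA K k i) δ).Finite ∧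
    (RadialPartition.partitionsIn (RadialPartition.setB K k i) δ).Finite ∧
    RadialPartition.p (RadialPartition.setA K k i) δ =
      RadialPartition.p (RadialPartition.setB K k i) δ := by
  refine ⟨(RadialPartition.finite_isPartitionOf δ).subset fun _ h => h.2,
    (RadialPartition.finite_isPartitionOf δ).subset fun _ h => h.2, ?_⟩
  obtain ⟨e, he⟩ := QSeries.exists_equiv_gordon hi hik
  have hA : RadialPartition.partitionsIn (RadialPartition.setA K k i) δ = _ :=
    Set.ext fun _ => RadialPartition.mem_partitionsIn_setA hi hik
  have hB : RadialPartition.partitionsIn (RadialPartition.setB K k i) δ = _ :=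
    Set.ext fun _ => RadialPartition.mem_partitionsIn_setB hi hik
  rw [RadialPartition.p, RadialPartition.p, hA, hB]
  exact RadialPartition.ncard_eq_of_equiv e he (fun _ h n hn => (h n hn).1) (fun _ h => h.1) δ
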